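/- For a finite graph $G$ and integers $r,t\ge 1$, the diameter cover number $D_r^t(G)$ is the least integer $d\ge 0$ such that for every $r$-colouring of the edges of $G$ (not necessarily proper) there are $t$ connected monochromatic subgraphs of $G$, each of diameter at most $d$ (distances being measured within the subgraph), such that every vertex of $G$ lies in at least one of them. Here a subgraph is monochromatic if all its edges have the same colour; in particular a single vertex is a monochromatic subgraph. Let $K_{a,b,c}$ denote the complete tripartite graph with parts of sizes $a,b,c$. Then \[ D_2^2(K_{4,3,2})=3,\qquad D_2^2(K_{4,2,2})=2,\qquad D_2^2(K_{3,3,3})=2 . \] -/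

import Mathlib

namespace DiameterCover

variable {V : Type*} {G : SimpleGraph V}

/-- A subgraph `H` of `G` is monochromatic under the edge colouring `C` if all of its edges
receive one common colour. (A subgraph without edges is monochromatic.) Edge colourings are
arbitrary maps from the edge set, with no properness condition. -/
def IsMonochromatic {r : ℕ} (C : G.EdgeLabeling (Fin r)) (H : G.Subgraph) : Prop :=
  ∃ k : Fin r, ∀ e (he : e ∈ H.edgeSet), C ⟨e, H.edgeSet_subset he⟩ = k

/-- `G` coloured by `C` has a cover by `t` monochromatic connected (hence non-empty) subgraphs,
each of diameter at most `d`. Distances are measured inside the subgraph itself, the subgraphs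
need not be induced, and they may share vertices. -/
def HasMonochromaticCover {r : ℕ} (C : G.EdgeLabeling (Fin r)) (t d : ℕ) : Prop :=
  ∃ H : Fin t → G.Subgraph,
    (∀ i, IsMonochromatic C (H i) ∧ (H i).Connected ∧ (H i).coe.ediam ≤ d) ∧
    ∀ v : V, ∃ i, v ∈ (H i).verts

/-- The diameter cover number `D_r^t(G)`: the least natural number `d` such that under every
`r`-colouring of the edges, `G` has a cover by `t` monochromatic connected subgraphs of diameter
at most `d`; it is `⊤` if there is no such `d`. -/
noncomputable def diameterCoverNumber (G : SimpleGraph V) (r t : ℕ) : ℕ∞ :=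
  ⨅ (d : ℕ) (_ : ∀ C : G.EdgeLabeling (Fin r), HasMonochromaticCover C t d), (d : ℕ∞)

/-- The complete tripartite graph `K_{a,b,c}`. -/
abbrev completeTripartiteGraph (a b c : ℕ) :
    SimpleGraph (Σ i : Fin 3, Fin (![a, b, c] i)) :=
  SimpleGraph.completeMultipartiteGraph (fun i : Fin 3 => Fin (![a, b, c] i))

end DiameterCover

namespace DiameterCover

/-! ### Truth tables

A Boolean function of `q` variables is stored as a natural number below `2 ^ 2 ^ q`: its value at
the assignment with binary code `i` is the `i`-th bit. The definitions use recursors directly, so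
that the kernel evaluates them quickly. -/

/-! Upper bounds come from an exhaustive check of all colourings, made feasible by symmetry and bit
parallelism. Permuting vertices inside two of the parts and exchanging the colours brings the edges
between these parts to one of a few normal forms (`IsNormalForms`). The third part may still be
permuted, so its first three edges from vertex 0 can be sorted: four triples instead of eight, which
saves one variable. This leaves `q` Boolean variables, and a statement about all `2 ^ q` remaining
colourings is one number with `2 ^ q` bits. Bitwise operations on such numbers compute, for every
colouring at once, whether some split of the vertices into two sets gives bounded diameter in one
colour on each set. Only soundness is needed: bit `i` of `coverTable` being set yields a cover of
colouring `i` (`hasMonochromaticCover_of_coverTable`), and the kernel verifies that all bits are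
set.

Lower bounds: a subgraph of diameter at most one is a clique, so it has at most one vertex in each
part; two of them cover at most six vertices, too few for `K_{4,2,2}` and `K_{3,3,3}`. For
`K_{4,3,2}` an explicit colouring is checked against all pairs of the 512 vertex sets. -/

/-- Pointwise disjunction of two truth tables. -/
def tableOr (a b : ℕ) : ℕ := Bool.rec (Nat.lor a b) b (Nat.beq a 0)

/-- Pointwise conjunction of two truth tables. -/
def tableAnd (a b : ℕ) : ℕ := Bool.rec (Nat.land a b) 0 (Nat.beq a 0)

/-- The disjunction of a family of truth tables indexed by a list. -/
def tableAny (l : List ℕ) (f : ℕ → ℕ) : ℕ := List.rec 0 (fun w _ r => tableOr (f w) r) l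

/-- The constantly true table in `q` variables. -/
def tableTrue (q : ℕ) : ℕ := Nat.sub (Nat.pow 2 (Nat.pow 2 q)) 1

/-- The table of the `j`-th variable among `q` variables. -/
def tableVar (j q : ℕ) : ℕ :=
  Nat.rec 0 (fun n r => Bool.rec (Nat.lor r (Nat.shiftLeft r (Nat.pow 2 n)))
    (Nat.shiftLeft (tableTrue n) (Nat.pow 2 n)) (Nat.beq n j)) q

theorem tableOr_eq (a b : ℕ) : tableOr a b = a ||| b := by
  unfold tableOr
  cases h : Nat.beq a 0
  · rfl
  · simp [Nat.eq_of_beq_eq_true h]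

theorem tableAnd_eq (a b : ℕ) : tableAnd a b = a &&& b := by
  unfold tableAnd
  cases h : Nat.beq a 0
  · rfl
  · simp [Nat.eq_of_beq_eq_true h]

theorem testBit_tableOr {a b i : ℕ} :
    (tableOr a b).testBit i = true ↔ a.testBit i = true ∨ b.testBit i = true := by
  simp [tableOr_eq]

theorem testBit_tableAnd {a b i : ℕ} :
    (tableAnd a b).testBit i = true ↔ a.testBit i = true ∧ b.testBit i = true := by
  simp [tableAnd_eq]

theorem testBit_tableAny {l : List ℕ} {f : ℕ → ℕ} {i : ℕ} :
    (tableAny l f).testBit i = true ↔ ∃ w ∈ l, (f w).testBit i = true := by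
  induction l with
  | nil => simp [tableAny]
  | cons w l ih =>
    rw [show tableAny (w :: l) f = tableOr (f w) (tableAny l f) from rfl, testBit_tableOr, ih]
    simp

theorem tableTrue_eq (q : ℕ) : tableTrue q = 2 ^ 2 ^ q - 1 := rfl

theorem testBit_tableTrue {q i : ℕ} (hi : i < 2 ^ q) : (tableTrue q).testBit i = true := by
  simp [tableTrue_eq, Nat.testBit_two_pow_sub_one, hi]

theorem tableVar_succ (j n : ℕ) : tableVar j (n + 1) =
    if n = j then tableTrue n <<< 2 ^ n else tableVar j n ||| tableVar j n <<< 2 ^ n := by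
  change Bool.rec (motive := fun _ => ℕ) (Nat.lor (tableVar j n) (Nat.shiftLeft (tableVar j n) (Nat.pow 2 n)))
    (Nat.shiftLeft (tableTrue n) (Nat.pow 2 n)) (Nat.beq n j) = _
  cases h : Nat.beq n j
  · rw [if_neg (Nat.ne_of_beq_eq_false h)]; rfl
  · rw [if_pos (Nat.eq_of_beq_eq_true h)]; rfl

theorem shiftLeft_two_pow_lt {a n : ℕ} (h : a < 2 ^ 2 ^ n) : a <<< 2 ^ n < 2 ^ 2 ^ (n + 1) := by
  rw [Nat.shiftLeft_eq, pow_succ 2 n, mul_two, pow_add]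
  exact Nat.mul_lt_mul_of_pos_right h (by positivity)

theorem tableVar_lt (j n : ℕ) : tableVar j n < 2 ^ 2 ^ n := by
  induction n with
  | zero => simp [tableVar]
  | succ n ih =>
    rw [tableVar_succ]
    split_ifs
    · exact shiftLeft_two_pow_lt (by rw [tableTrue_eq]; exact Nat.sub_lt (by positivity) one_pos)
    · exact Nat.or_lt_two_pow
        (ih.trans_le (Nat.pow_le_pow_right two_pos (Nat.pow_le_pow_right two_pos n.le_succ)))
        (shiftLeft_two_pow_lt ih)

/-- A table in `n + 1` variables is two tables of length `2 ^ n` laid end to end, the upper one for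
variable `n` true. An older variable repeats its table; variable `n` is zeros followed by ones. -/
theorem testBit_tableVar {j n i : ℕ} (hj : j < n) (hi : i < 2 ^ n) :
    (tableVar j n).testBit i = i.testBit j := by
  induction n generalizing i with
  | zero => omega
  | succ n ih =>
    rw [tableVar_succ]
    have hsub : 2 ^ n ≤ i → i - 2 ^ n < 2 ^ n := fun h => by rw [pow_succ] at hi; omega
    rcases lt_or_ge i (2 ^ n) with h | h
    · split_ifs with hnj
      · subst hnj
        simp [Nat.testBit_shiftLeft, h, Nat.testBit_lt_two_pow h]
      · simp [Nat.testBit_shiftLeft, h, ih (by omega) h]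
    · obtain ⟨k, rfl⟩ := Nat.exists_eq_add_of_le h
      have hk : k < 2 ^ n := by simpa using hsub h
      split_ifs with hnj
      · subst hnj
        simp [Nat.testBit_shiftLeft, testBit_tableTrue hk, Nat.testBit_two_pow_add_eq,
          Nat.testBit_lt_two_pow hk]
      · have hjn : j < n := by omega
        have hbig : (tableVar j n).testBit (2 ^ n + k) = false :=
          Nat.testBit_lt_two_pow ((tableVar_lt j n).trans_le
            (Nat.pow_le_pow_right two_pos (Nat.le_add_right _ _)))
        simp [Nat.testBit_shiftLeft, hbig, ih hjn hk, Nat.testBit_two_pow_add_gt hjn]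

/-! ### Tables for covers by two sets of bounded diameter -/

/-- The table of the assertion that `u` and `v` are joined by a path of length at most `d + 1`
inside `S`, where `X u v` is the table of adjacency. -/
def tableDist (X : ℕ → ℕ → ℕ) (S : List ℕ) (d : ℕ) : ℕ → ℕ → ℕ :=
  Nat.rec (fun u v => X u v) (fun _ r u v => tableOr (X u v) (tableAny S fun w =>
    Bool.rec (tableAnd (X w v) (r u w)) 0 (Nat.beq w u))) d

/-- The table of the assertion that `f u v` holds for any two members of `S`. -/
def tablePairwise (q : ℕ) (f : ℕ → ℕ → ℕ) (S : List ℕ) : ℕ :=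
  List.rec (tableTrue q) (fun u l r => List.rec r (fun v _ r' => tableAnd (f u v) r') l) S

/-- The table of the assertion that the set `S` is non-empty and has diameter at most `d + 1` in
one of the two colours. -/
def tableBounded (q : ℕ) (X : Bool → ℕ → ℕ → ℕ) (d : ℕ) (S : List ℕ) : ℕ :=
  Bool.rec (tableOr (tablePairwise q (tableDist (X true) S d) S)
    (tablePairwise q (tableDist (X false) S d) S)) 0 (List.isEmpty S)

/-- The disjunction, over all ways of adding each member of `vs` to either `S` or `T` such that
the resulting `S` is `valid`, of the conjunction of `F S` and `F T`. -/
def tableSplit (valid : List ℕ → Bool) (F : List ℕ → ℕ) (vs S T : List ℕ) : ℕ :=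
  List.rec (motive := fun _ => List ℕ → List ℕ → ℕ)
    (fun S T => Bool.rec 0 (tableAnd (F T) (F S)) (valid S))
    (fun v _ r S T => Nat.lor (r (v :: S) T) (r S (v :: T))) vs S T

theorem testBit_tablePairwise {q i : ℕ} {f : ℕ → ℕ → ℕ} {S : List ℕ}
    (h : (tablePairwise q f S).testBit i = true) :
    S.Pairwise fun u v => (f u v).testBit i = true := by
  induction S with
  | nil => exact List.Pairwise.nil
  | cons u l ih =>
    change (List.rec (tablePairwise q f l) (fun v _ r' => tableAnd (f u v) r') l :
      ℕ).testBit i = true at h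
    have key : ∀ (l' : List ℕ) (r : ℕ),
        (List.rec r (fun v _ r' => tableAnd (f u v) r') l' : ℕ).testBit i = true →
        r.testBit i = true ∧ ∀ v ∈ l', (f u v).testBit i = true := by
      intro l' r
      induction l' with
      | nil => intro h; exact ⟨h, by simp⟩
      | cons v l' ih' =>
        intro h
        have h' := testBit_tableAnd.1 h
        obtain ⟨h1, h2⟩ := ih' h'.2
        exact ⟨h1, List.forall_mem_cons.2 ⟨h'.1, h2⟩⟩
    obtain ⟨h1, h2⟩ := key l _ h
    exact List.Pairwise.cons h2 (ih h1)

/-- Rejecting a split through `valid` only clears bits, so `valid` prunes the search without any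
hypothesis on it. -/
theorem testBit_tableSplit {valid : List ℕ → Bool} {F : List ℕ → ℕ} {vs S T : List ℕ} {i : ℕ}
    (h : (tableSplit valid F vs S T).testBit i = true) :
    ∃ S' T' : List ℕ, (F S').testBit i = true ∧ (F T').testBit i = true ∧
      S' ⊆ S ++ vs ∧ T' ⊆ T ++ vs ∧ S ++ T ++ vs ⊆ S' ++ T' := by
  induction vs generalizing S T with
  | nil =>
    change (Bool.rec 0 (tableAnd (F T) (F S)) (valid S) : ℕ).testBit i = true at h
    cases hv : valid S
    · simp [hv] at h
    · rw [hv] at h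
      have h' := testBit_tableAnd.1 h
      exact ⟨S, T, h'.2, h'.1, by simp, by simp, by simp⟩
  | cons v vs ih =>
    have h' : (tableSplit valid F vs (v :: S) T ||| tableSplit valid F vs S (v :: T)).testBit i =
      true := h
    rw [Nat.testBit_or, Bool.or_eq_true] at h'
    rcases h' with h | h
    all_goals
      obtain ⟨S', T', h1, h2, h3, h4, h5⟩ := ih h
      refine ⟨S', T', h1, h2, fun x hx => ?_, fun x hx => ?_, fun x hx => h5 ?_⟩
      · have := h3 hx; simp at this ⊢; tauto
      · have := h4 hx; simp at this ⊢; tauto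
      · simp at hx ⊢; tauto

/-! ### From table bits to monochromatic subgraphs -/

variable {V : Type*} {G : SimpleGraph V}

/-- A subgraph of one colour whose vertex set is enumerated by `S`. -/
def colourSubgraph {r : ℕ} (C : G.EdgeLabeling (Fin r)) (k : Fin r) (e : ℕ → V) (S : List ℕ) :
    G.Subgraph where
  verts := {x | ∃ v ∈ S, e v = x}
  Adj x y := (∃ v ∈ S, e v = x) ∧ (∃ v ∈ S, e v = y) ∧ ∃ h : G.Adj x y, C.get x y h = k
  adj_sub := fun ⟨_, _, h, _⟩ => h
  edge_vert := fun ⟨h, _⟩ => h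
  symm := ⟨fun x y ⟨hx, hy, h, hk⟩ => ⟨hy, hx, h.symm, by rw [C.get_comm]; exact hk⟩⟩

theorem isMonochromatic_colourSubgraph {r : ℕ} (C : G.EdgeLabeling (Fin r)) (k : Fin r)
    (e : ℕ → V) (S : List ℕ) : IsMonochromatic C (colourSubgraph C k e S) := by
  refine ⟨k, fun s hs => ?_⟩
  induction s with
  | _ x y =>
    obtain ⟨_, _, h, hk⟩ := (SimpleGraph.Subgraph.mem_edgeSet).1 hs
    exact hk

theorem edist_le_of_testBit_tableDist {r : ℕ} {C : G.EdgeLabeling (Fin r)} {k : Fin r}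
    {e : ℕ → V} {S : List ℕ} {X : ℕ → ℕ → ℕ} {i d : ℕ}
    (hX : ∀ u ∈ S, ∀ v ∈ S, (X u v).testBit i = true →
      ∃ h : G.Adj (e u) (e v), C.get (e u) (e v) h = k)
    {u v : ℕ} (hu : u ∈ S) (hv : v ∈ S) (h : (tableDist X S d u v).testBit i = true) :
    (colourSubgraph C k e S).coe.edist ⟨e u, u, hu, rfl⟩ ⟨e v, v, hv, rfl⟩ ≤ (d + 1 : ℕ) := by
  have adj : ∀ {u v : ℕ} (hu : u ∈ S) (hv : v ∈ S), (X u v).testBit i = true →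
      (colourSubgraph C k e S).coe.edist ⟨e u, u, hu, rfl⟩ ⟨e v, v, hv, rfl⟩ ≤ 1 := by
    intro u v hu hv h
    refine (SimpleGraph.edist_eq_one_iff_adj.2 ?_).le
    exact ⟨⟨u, hu, rfl⟩, ⟨v, hv, rfl⟩, hX u hu v hv h⟩
  induction d generalizing v with
  | zero => simpa using adj hu hv h
  | succ d ih =>
    rcases testBit_tableOr.1 (show (tableOr (X u v) (tableAny S fun w =>
      Bool.rec (tableAnd (X w v) (tableDist X S d u w)) 0 (Nat.beq w u))).testBit i = true from h)
      with h | h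
    · exact (adj hu hv h).trans (by simp)
    · obtain ⟨w, hw, h⟩ := testBit_tableAny.1 h
      cases hwu : Nat.beq w u
      · rw [hwu] at h
        have h' := testBit_tableAnd.1 h
        -- The path from `u` to `w` is extended by the last edge `w v`.
        refine SimpleGraph.edist_triangle.trans ((add_le_add (ih hw h'.2) (adj hw hv h'.1)).trans ?_)
        push_cast
        exact le_rfl
      · simp [hwu] at h

/-- A table for `tableBounded` that is true at a colouring yields a suitable subgraph. -/
theorem exists_subgraph_of_testBit_tableBounded {r : ℕ} {C : G.EdgeLabeling (Fin r)}
    {κ : Bool → Fin r} {e : ℕ → V} {S : List ℕ} {X : Bool → ℕ → ℕ → ℕ} {i d q : ℕ}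
    (hX : ∀ k, ∀ u ∈ S, ∀ v ∈ S, (X k u v).testBit i = true →
      ∃ h : G.Adj (e u) (e v), C.get (e u) (e v) h = κ k)
    (h : (tableBounded q X d S).testBit i = true) :
    ∃ H : G.Subgraph, (IsMonochromatic C H ∧ H.Connected ∧ H.coe.ediam ≤ (d + 1 : ℕ)) ∧
      ∀ v ∈ S, e v ∈ H.verts := by
  have hS : ∃ w, w ∈ S ∧ ∃ k, S.Pairwise fun u v =>
      (tableDist (X k) S d u v).testBit i = true := by
    cases S with
    | nil => simp [tableBounded] at h
    | cons w S =>
      refine ⟨w, by simp, ?_⟩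
      rcases testBit_tableOr.1 h with h | h
      · exact ⟨true, testBit_tablePairwise h⟩
      · exact ⟨false, testBit_tablePairwise h⟩
  obtain ⟨w, hw, k, hk⟩ := hS
  have hdiam : (colourSubgraph C (κ k) e S).coe.ediam ≤ (d + 1 : ℕ) := by
    refine SimpleGraph.ediam_le_of_edist_le ?_
    rintro ⟨_, u, hu, rfl⟩ ⟨_, v, hv, rfl⟩
    let R : ℕ → ℕ → Prop := fun u v => ∀ (hu : u ∈ S) (hv : v ∈ S),
      (colourSubgraph C (κ k) e S).coe.edist ⟨e u, u, hu, rfl⟩ ⟨e v, v, hv, rfl⟩ ≤ (d + 1 : ℕ)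
    have : Std.Symm R := ⟨fun u v h hu hv => by rw [SimpleGraph.edist_comm]; exact h hv hu⟩
    -- The table tests each pair in one order only; symmetry of distance and distance zero on the
    -- diagonal supply the rest.
    refine List.Pairwise.forall_of_forall (R := R) (fun u _ _ _ => ?_)
      (hk.imp fun h hu hv => ?_) hu hv hu hv
    · simp
    · exact edist_le_of_testBit_tableDist (hX k) hu hv h
  refine ⟨_, ⟨isMonochromatic_colourSubgraph C (κ k) e S, ⟨?_⟩, hdiam⟩, fun v hv => ⟨v, hv, rfl⟩⟩
  have : Nonempty (colourSubgraph C (κ k) e S).verts := ⟨⟨e w, w, hw, rfl⟩⟩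
  -- Connectedness needs no separate test: a finite extended diameter implies it.
  exact SimpleGraph.connected_of_ediam_ne_top (ne_top_of_le_ne_top (ENat.natCast_ne_top _) hdiam)

theorem hasMonochromaticCover_of_testBit_tableSplit {r : ℕ} {C : G.EdgeLabeling (Fin r)}
    {κ : Bool → Fin r} {e : ℕ → V} {vs S T : List ℕ} {X : Bool → ℕ → ℕ → ℕ} {i d q : ℕ}
    {valid : List ℕ → Bool}
    (hX : ∀ k, ∀ u ∈ S ++ T ++ vs, ∀ v ∈ S ++ T ++ vs, (X k u v).testBit i = true →
      ∃ h : G.Adj (e u) (e v), C.get (e u) (e v) h = κ k)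
    (he : ∀ x, ∃ v ∈ S ++ T ++ vs, e v = x)
    (h : (tableSplit valid (tableBounded q X d) vs S T).testBit i = true) :
    HasMonochromaticCover C 2 (d + 1) := by
  obtain ⟨S', T', hS, hT, hS', hT', hST⟩ := testBit_tableSplit h
  have hS'' : S' ⊆ S ++ T ++ vs := fun x hx => by have := hS' hx; simp at this ⊢; tauto
  have hT'' : T' ⊆ S ++ T ++ vs := fun x hx => by have := hT' hx; simp at this ⊢; tauto
  obtain ⟨H₀, hH₀, hv₀⟩ := exists_subgraph_of_testBit_tableBounded
    (fun k u hu v hv => hX k u (hS'' hu) v (hS'' hv)) hS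
  obtain ⟨H₁, hH₁, hv₁⟩ := exists_subgraph_of_testBit_tableBounded
    (fun k u hu v hv => hX k u (hT'' hu) v (hT'' hv)) hT
  refine ⟨![H₀, H₁], Fin.forall_fin_two.2 ⟨hH₀, hH₁⟩, fun x => ?_⟩
  obtain ⟨v, hv, rfl⟩ := he x
  rcases List.mem_append.1 (hST hv) with h | h
  · exact ⟨0, hv₀ v h⟩
  · exact ⟨1, hv₁ v h⟩

/-! ### Normal forms of small two-coloured complete bipartite graphs -/

/-- Up to permutations of rows and columns and complementation, every `a × b` matrix of Booleans
is coded by a member of `reps`. -/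
def IsNormalForms (a b : ℕ) (reps : List ℕ) : Prop :=
  ∀ M : Fin a → Fin b → Bool, ∃ (σ : Equiv.Perm (Fin a)) (τ : Equiv.Perm (Fin b)) (x : Bool),
    ∃ m ∈ reps, ∀ i j, (M (σ i) (τ j) ^^ x) = m.testBit (i * b + j)

theorem isNormalForms_two_two : IsNormalForms 2 2 [0, 1, 3, 5, 6] := by
  unfold IsNormalForms
  decide +kernel

theorem isNormalForms_two_three : IsNormalForms 2 3 [0, 1, 3, 7, 9, 10, 11, 14] := by
  unfold IsNormalForms
  decide +kernel

/-- The permutations of three points. -/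
def permsThree : List (Equiv.Perm (Fin 3)) :=
  [1, Equiv.swap 0 1, Equiv.swap 0 2, Equiv.swap 1 2, Equiv.swap 0 1 * Equiv.swap 1 2,
    Equiv.swap 1 2 * Equiv.swap 0 1]

/-- The entry of the permuted matrix coded by `m`. -/
def permutedEntry (m : ℕ) (σ τ : Equiv.Perm (Fin 3)) (i j : Fin 3) : Bool :=
  Nat.testBit m ((σ i).val * 3 + (τ j).val)

/-- The code of the permuted and possibly complemented matrix coded by `m`. -/
def permutedCode (m : ℕ) (σ τ : Equiv.Perm (Fin 3)) (x : Bool) : ℕ :=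
  let c := List.rec 0 (fun p _ r => Nat.add (Nat.mul 2 r)
    (Bool.rec 0 1 (permutedEntry m σ τ p.1 p.2)))
    [(0, 0), (0, 1), (0, 2), (1, 0), (1, 1), (1, 2), (2, 0), (2, 1), (2, 2)]
  Bool.rec c (Nat.sub 511 c) x

/-- The normal forms of `3 × 3` matrices. -/
def normalFormsThree : List ℕ :=
  [0, 1, 3, 7, 9, 10, 11, 14, 15, 27, 29, 73, 74, 75, 78, 83, 84, 85]

/-- The bit mask of `normalFormsThree`, for a fast membership test. -/
def normalFormsThreeMask : ℕ := 68068190484083066781355659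

/-- The mask rejects a bad code by a single bit test; soundness rests on the list test and the
entrywise comparison behind it. -/
theorem exists_permutedCode_mem :
    (List.range 512).all (fun m => permsThree.any fun σ => permsThree.any fun τ =>
      [false, true].any fun x => normalFormsThreeMask.testBit (permutedCode m σ τ x) &&
        (normalFormsThree.contains (permutedCode m σ τ x) &&
        decide (∀ i j : Fin 3, (permutedEntry m σ τ i j ^^ x) =
          (permutedCode m σ τ x).testBit (i * 3 + j)))) = true := by
  decide +kernel

theorem isNormalForms_three_three : IsNormalForms 3 3 normalFormsThree := by
  intro M
  set m := Nat.ofBits (n := 9) fun t => M (Fin.divNat (m := 3) (n := 3) t)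
    (Fin.modNat (m := 3) (n := 3) t) with hm
  have hM : ∀ i j : Fin 3, m.testBit (i.val * 3 + j.val) = M i j := by
    intro i j
    rw [hm, Nat.testBit_ofBits_lt _ _ (by omega)]
    congr 1
    · ext; simp; omega
    · ext; simp
  have h := List.all_eq_true.1 exists_permutedCode_mem m
    (List.mem_range.2 (Nat.ofBits_lt_two_pow _))
  simp only [List.any_eq_true, Bool.and_eq_true, decide_eq_true_eq] at h
  obtain ⟨σ, -, τ, -, x, -, -, hc, h⟩ := h
  refine ⟨σ, τ, x, _, List.contains_iff_mem.1 hc, fun i j => ?_⟩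
  rw [← h i j, permutedEntry, hM]

/-- Three Booleans on the first three points of `Fin n` can be sorted by a permutation. -/
theorem exists_perm_sorted {n : ℕ} (f : Fin (n + 3) → Bool) :
    ∃ (ρ : Equiv.Perm (Fin (n + 3))) (s : Bool),
      f (ρ 0) = (f (ρ 1) && s) ∧ f (ρ 2) = (f (ρ 1) || s) := by
  have hmono := Tuple.monotone_sort f
  have h01 : f (Tuple.sort f 0) ≤ f (Tuple.sort f 1) := hmono (Fin.zero_le _)
  have h12 : f (Tuple.sort f 1) ≤ f (Tuple.sort f 2) := hmono (by
    rw [Fin.le_def]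
    simp [Nat.mod_eq_of_lt])
  -- Once the middle value is known, monotonicity leaves one outer value free, and `s` records it.
  refine ⟨Tuple.sort f, if f (Tuple.sort f 1) then f (Tuple.sort f 0) else f (Tuple.sort f 2), ?_⟩
  revert h01 h12
  generalize f (Tuple.sort f 0) = a
  generalize f (Tuple.sort f 1) = b
  generalize f (Tuple.sort f 2) = c
  revert a b c
  decide

/-! ### Tables of the edges of a complete tripartite graph

The vertices are numbered consecutively, first the `a` vertices of the first part, then the `b`
vertices of the second part and finally the `c` vertices of the third part. -/

/-- The part containing the vertex `v`. -/
def partIndex (a b v : ℕ) : ℕ :=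
  Bool.rec (Bool.rec 2 1 (Nat.blt v (Nat.add a b))) 0 (Nat.blt v a)

/-- The colours of the edges from the first two parts to the third one, numbered by `t`. Those
with number `0`, `1`, `2` run through the sorted triples. -/
def crossTable (q t : ℕ) : ℕ :=
  Bool.rec (Bool.rec (tableVar (Nat.pred t) q) (tableOr (tableVar 0 q) (tableVar 1 q))
    (Nat.beq t 2)) (tableAnd (tableVar 0 q) (tableVar 1 q)) (Nat.beq t 0)

/-- The colour of the edge between `u` and `v`, where `u < v`. The colours between the first two
parts are coded by `m`. -/
def colourTable (a b c q m u v : ℕ) : ℕ :=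
  Bool.rec (crossTable q (Nat.add (Nat.mul u c) (Nat.sub v (Nat.add a b))))
    (Bool.rec 0 (tableTrue q) (Nat.testBit m (Nat.add (Nat.mul u b) (Nat.sub v a))))
    (Nat.blt v (Nat.add a b))

/-- The table of the assertion that the edge between `u` and `v`, where `u < v`, has colour
`k`. -/
def halfEdgeTable (a b c q m : ℕ) (k : Bool) (u v : ℕ) : ℕ :=
  Bool.rec (Nat.xor (tableTrue q) (colourTable a b c q m u v)) (colourTable a b c q m u v) k

/-- The table of the assertion that there is an edge between `u` and `v` of colour `k`. -/
def edgeTable (a b c q m : ℕ) (k : Bool) (u v : ℕ) : ℕ :=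
  Bool.rec (Bool.rec (halfEdgeTable a b c q m k u v) (halfEdgeTable a b c q m k v u) (Nat.blt v u))
    0 (Nat.beq (partIndex a b u) (partIndex a b v))

/-- The profile of a set of vertices: its decimal digits count the vertices in each part. -/
def profile (a b : ℕ) (S : List ℕ) : ℕ :=
  List.rec 0 (fun v _ r => Nat.add (Nat.pow 10 (partIndex a b v)) r) S

/-- Membership in a list of numbers. -/
def memList (l : List ℕ) (n : ℕ) : Bool :=
  List.rec false (fun x _ r => Bool.rec r true (Nat.beq x n)) l

/-- The table of the assertion that there is a cover by two monochromatic sets of diameter at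
most `d + 1`, which either are disjoint, one of them having its profile in `P`, or share one
vertex in `O`, one of them having its profile in `P'`. -/
def coverTable (a b c q d : ℕ) (vs P O P' : List ℕ) (m : ℕ) : ℕ :=
  Nat.lor (tableSplit (fun S => memList P (profile a b S))
      (tableBounded q (edgeTable a b c q m) d) vs [] [])
    (tableAny O fun x => tableSplit (fun S => memList P' (profile a b S))
      (tableBounded q (edgeTable a b c q m) d) (vs.filter fun v => !Nat.beq v x) [x] [x])

/-! ### From colourings of the tripartite graph to bits of the tables -/

theorem bool_rec_eq {α : Type*} (x y : α) (b : Bool) :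
    (Bool.rec x y b : α) = if b then y else x := by
  cases b <;> rfl

theorem partIndex_eq (a b v : ℕ) :
    partIndex a b v = if v < a then 0 else if v < a + b then 1 else 2 := by
  simp [partIndex, bool_rec_eq, Nat.blt_eq]

theorem testBit_crossTable_eq {q t i : ℕ} (hq : 2 ≤ q) (ht : t ≤ q) (hi : i < 2 ^ q) :
    (crossTable q t).testBit i = if t = 0 then i.testBit 0 && i.testBit 1 else
      if t = 2 then i.testBit 0 || i.testBit 1 else i.testBit (t - 1) := by
  simp only [crossTable, bool_rec_eq, Nat.beq_eq]
  split_ifs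
  · simp [tableAnd_eq, testBit_tableVar (show 0 < q by omega) hi,
      testBit_tableVar (show 1 < q by omega) hi]
  · simp [tableOr_eq, testBit_tableVar (show 0 < q by omega) hi,
      testBit_tableVar (show 1 < q by omega) hi]
  · exact testBit_tableVar (show t - 1 < q by omega) hi

/-- Every sequence of Booleans starting with a sorted triple occurs in `crossTable`. -/
theorem exists_testBit_crossTable {q : ℕ} (hq : 2 ≤ q) (g : ℕ → Bool) {s : Bool}
    (h0 : g 0 = (g 1 && s)) (h2 : g 2 = (g 1 || s)) :
    ∃ i < 2 ^ q, ∀ t ≤ q, (crossTable q t).testBit i = g t := by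
  have hb : ∀ t < q, (Nat.ofBits fun t : Fin q => if t.val = 1 then s else g (t + 1)).testBit t =
      if t = 1 then s else g (t + 1) := fun t ht => Nat.testBit_ofBits_lt _ _ ht
  refine ⟨_, Nat.ofBits_lt_two_pow fun t : Fin q => if t.val = 1 then s else g (t + 1),
    fun t ht => ?_⟩
  rw [testBit_crossTable_eq hq ht (Nat.ofBits_lt_two_pow _), hb 0 (by omega), hb 1 (by omega),
    if_neg zero_ne_one, if_pos rfl, zero_add]
  by_cases h : t = 0
  · rw [if_pos h, h, h0]
  by_cases h' : t = 2
  · rw [if_neg h, if_pos h', h', h2]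
  rw [if_neg h, if_neg h', hb _ (by omega), if_neg (by omega)]
  congr 1
  omega

theorem edgeTable_comm (a b c q m : ℕ) (k : Bool) (u v : ℕ) :
    edgeTable a b c q m k u v = edgeTable a b c q m k v u := by
  simp only [edgeTable, bool_rec_eq, Nat.beq_eq, Nat.blt_eq]
  rcases lt_trichotomy u v with h | rfl | h
  · simp [h, h.not_gt, eq_comm]
  · rfl
  · simp [h, h.not_gt, eq_comm]

theorem testBit_edgeTable {a b c q m i : ℕ} {k : Bool} {u v : ℕ} (hi : i < 2 ^ q) (huv : u < v)
    (h : (edgeTable a b c q m k u v).testBit i = true) :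
    partIndex a b u ≠ partIndex a b v ∧ (colourTable a b c q m u v).testBit i = k := by
  simp only [edgeTable, bool_rec_eq, Nat.beq_eq, Nat.blt_eq, huv.not_gt, if_false] at h
  split_ifs at h with hp
  · simp at h
  · refine ⟨hp, ?_⟩
    cases k
    · have h' : (tableTrue q ^^^ colourTable a b c q m u v).testBit i = true := h
      simpa [testBit_tableTrue hi] using h'
    · exact h

theorem testBit_colourTable {a b c q m i : ℕ} (hi : i < 2 ^ q) {χ : ℕ → ℕ → Bool}
    (hm : ∀ u < a, ∀ j < b, χ u (a + j) = m.testBit (u * b + j))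
    (hx : ∀ u < a + b, ∀ j < c, (crossTable q (u * c + j)).testBit i = χ u (a + b + j))
    {u v : ℕ} (huv : u < v) (hv : v < a + b + c) (hp : partIndex a b u ≠ partIndex a b v) :
    (colourTable a b c q m u v).testBit i = χ u v := by
  simp only [colourTable, bool_rec_eq, Nat.blt_eq]
  simp only [partIndex_eq] at hp
  have hua : u < a + b := by
    by_contra hc
    rw [if_neg (by omega), if_neg hc, if_neg (by omega), if_neg (by omega)] at hp
    exact hp rfl
  by_cases hvb : v < a + b
  · rw [if_pos (show v < Nat.add a b from hvb)]
    have hua' : u < a := by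
      by_contra hc
      rw [if_neg hc, if_pos hua, if_neg (by omega), if_pos hvb] at hp
      exact hp rfl
    have hva : a ≤ v := by
      by_contra hc
      rw [if_pos hua', if_pos (by omega)] at hp
      exact hp rfl
    obtain ⟨j, rfl⟩ := Nat.exists_eq_add_of_le hva
    rw [hm u hua' j (by omega)]
    change (if m.testBit (u * b + (a + j - a)) = true then tableTrue q else 0).testBit i = _
    rw [Nat.add_sub_cancel_left]
    split_ifs with h
    · rw [h, testBit_tableTrue hi]
    · simpa using h
  · rw [if_neg (show ¬v < Nat.add a b from hvb)]
    obtain ⟨j, rfl⟩ := Nat.exists_eq_add_of_le (not_lt.1 hvb)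
    rw [← hx u hua j (by omega)]
    change (crossTable q (u * c + (a + b + j - (a + b)))).testBit i = _
    rw [Nat.add_sub_cancel_left]

/-- The colour of the edge `s(x, y)`, as a Boolean. -/
noncomputable def edgeColour (C : G.EdgeLabeling (Fin 2)) (x y : V) : Bool :=
  open scoped Classical in decide (∃ h : G.Adj x y, C.get x y h = 1)

theorem get_eq_of_edgeColour {C : G.EdgeLabeling (Fin 2)} {x y : V} (h : G.Adj x y) {k : Bool}
    (hk : edgeColour C x y = k) : C.get x y h = if k then 1 else 0 := by
  subst hk
  by_cases hc : C.get x y h = 1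
  · simp [edgeColour, h, hc]
  · have : ¬ ∃ h : G.Adj x y, C.get x y h = 1 := fun ⟨_, h'⟩ => hc h'
    simp only [edgeColour, this, decide_false]
    revert hc
    generalize C.get x y h = z
    revert z
    decide

/-- A colouring of a complete tripartite graph whose vertices are numbered such that the colours
are in normal form has a cover whenever the corresponding table is constantly true. -/
theorem hasMonochromaticCover_of_coverTable {a b c q d m : ℕ} {vs P O P' : List ℕ}
    (hq : q + 1 = (a + b) * c) (hc : 3 ≤ c) (hab : 0 < a + b)
    (hvs : ∀ v, v ∈ vs ↔ v < a + b + c) (hO : O ⊆ vs)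
    (htab : coverTable a b c q d vs P O P' m = tableTrue q)
    {C : G.EdgeLabeling (Fin 2)} (e : ℕ → V) (x s : Bool)
    (hadj : ∀ u < a + b + c, ∀ v < a + b + c, partIndex a b u ≠ partIndex a b v →
      G.Adj (e u) (e v))
    (he : ∀ y, ∃ v < a + b + c, e v = y)
    (hm : ∀ u < a, ∀ j < b, (edgeColour C (e u) (e (a + j)) ^^ x) = m.testBit (u * b + j))
    (h0 : (edgeColour C (e 0) (e (a + b)) ^^ x) = ((edgeColour C (e 0) (e (a + b + 1)) ^^ x) && s))
    (h2 : (edgeColour C (e 0) (e (a + b + 2)) ^^ x) =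
      ((edgeColour C (e 0) (e (a + b + 1)) ^^ x) || s)) :
    HasMonochromaticCover C 2 (d + 1) := by
  have hq2 : 2 ≤ q := by nlinarith
  set χ : ℕ → ℕ → Bool := fun u v => edgeColour C (e u) (e v) ^^ x with hχ
  -- Cross edges are numbered row by row, `t = u * c + j`; since `3 ≤ c`, numbers 0, 1, 2 all belong
  -- to vertex 0, whose triple is sorted.
  obtain ⟨i, hi, hx⟩ := exists_testBit_crossTable hq2
    (fun t => χ (t / c) (a + b + t % c)) (s := s)
    (by simpa [Nat.div_eq_of_lt (show 1 < c by omega), Nat.mod_eq_of_lt (show 1 < c by omega)]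
      using h0)
    (by simpa [Nat.div_eq_of_lt (show 1 < c by omega), Nat.mod_eq_of_lt (show 1 < c by omega),
      Nat.div_eq_of_lt (show 2 < c by omega), Nat.mod_eq_of_lt (show 2 < c by omega)] using h2)
  have hx' : ∀ u < a + b, ∀ j < c, (crossTable q (u * c + j)).testBit i = χ u (a + b + j) := by
    intro u hu j hj
    have h1 : u * c + j ≤ q := by
      have : (u + 1) * c ≤ (a + b) * c := Nat.mul_le_mul_right c hu
      rw [add_mul, one_mul] at this
      omega
    have h2 : (u * c + j) / c = u := by
      rw [mul_comm, Nat.mul_add_div (by omega), Nat.div_eq_of_lt hj, add_zero]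
    have h3 : (u * c + j) % c = j := by
      rw [mul_comm, Nat.mul_add_mod, Nat.mod_eq_of_lt hj]
    simpa only [h2, h3] using hx _ h1
  have hlt : ∀ k u v, u < v → v < a + b + c → (edgeTable a b c q m k u v).testBit i = true →
      ∃ h : G.Adj (e u) (e v), C.get (e u) (e v) h = if (k ^^ x) then 1 else 0 := by
    intro k u v huv hv h
    obtain ⟨hp, hk⟩ := testBit_edgeTable hi huv h
    rw [testBit_colourTable hi (χ := χ) hm hx' huv hv hp] at hk
    refine ⟨hadj u (by omega) v hv hp, get_eq_of_edgeColour _ ?_⟩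
    rw [← hk, hχ]
    simp
  have hX : ∀ k, ∀ u < a + b + c, ∀ v < a + b + c, (edgeTable a b c q m k u v).testBit i = true →
      ∃ h : G.Adj (e u) (e v), C.get (e u) (e v) h = if (k ^^ x) then 1 else 0 := by
    intro k u hu v hv h
    rcases lt_trichotomy u v with huv | rfl | huv
    · exact hlt k u v huv hv h
    · simp [edgeTable, bool_rec_eq] at h
    · rw [edgeTable_comm] at h
      obtain ⟨h, hk⟩ := hlt k v u huv hu h
      exact ⟨h.symm, by rw [C.get_comm]; exact hk⟩
  have hT := testBit_tableTrue hi
  rw [← htab] at hT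
  rw [show coverTable a b c q d vs P O P' m = _ ||| _ from rfl, Nat.testBit_or,
    Bool.or_eq_true] at hT
  rcases hT with hT | hT
  -- This `κ` undoes the exchange of colours recorded by `x`.
  · exact hasMonochromaticCover_of_testBit_tableSplit (κ := fun k => if (k ^^ x) then 1 else 0)
      (fun k u hu v hv => hX k u ((hvs u).1 (by simpa using hu)) v ((hvs v).1 (by simpa using hv)))
      (fun y => by simpa [hvs] using he y) hT
  · obtain ⟨w, hw, hT⟩ := testBit_tableAny.1 hT
    have hmem : ∀ v, v ∈ [w] ++ [w] ++ (vs.filter fun v => !Nat.beq v w) ↔ v < a + b + c := by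
      intro v
      rw [← hvs v]
      have := hO hw
      by_cases hvw : v = w
      · simp [hvw, this]
      · have hvw' : Nat.beq v w = false :=
          Bool.eq_false_iff.2 fun h => hvw (Nat.eq_of_beq_eq_true h)
        simp [hvw, hvw']
    exact hasMonochromaticCover_of_testBit_tableSplit (κ := fun k => if (k ^^ x) then 1 else 0)
      (fun k u hu v hv => hX k u ((hmem u).1 hu) v ((hmem v).1 hv))
      (fun y => by simpa only [hmem] using he y) hT

/-- If the tables of all normal forms are constantly true, every two-colouring of a graph with a
spanning complete tripartite subgraph has a cover. -/
theorem hasMonochromaticCover_of_forall_coverTable {a b n q d : ℕ} [NeZero a] [NeZero b]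
    {reps vs P O P' : List ℕ} (hreps : IsNormalForms a b reps) (hq : q + 1 = (a + b) * (n + 3))
    (hvs : ∀ v, v ∈ vs ↔ v < a + b + (n + 3)) (hO : O ⊆ vs)
    (htab : ∀ m ∈ reps, coverTable a b (n + 3) q d vs P O P' m = tableTrue q)
    (p₀ : Fin a → V) (p₁ : Fin b → V) (p₂ : Fin (n + 3) → V)
    (h₀₁ : ∀ i j, G.Adj (p₀ i) (p₁ j)) (h₀₂ : ∀ i j, G.Adj (p₀ i) (p₂ j))
    (h₁₂ : ∀ i j, G.Adj (p₁ i) (p₂ j))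
    (hp : ∀ y, (∃ i, p₀ i = y) ∨ (∃ i, p₁ i = y) ∨ ∃ i, p₂ i = y)
    (C : G.EdgeLabeling (Fin 2)) : HasMonochromaticCover C 2 (d + 1) := by
  obtain ⟨σ, τ, x, m, hm, hM⟩ := hreps fun i j => edgeColour C (p₀ i) (p₁ j)
  -- The sorting comes after the normal form, as it depends on `σ` and `x`; permuting the third part
  -- leaves the matrix between the other two unchanged.
  obtain ⟨ρ, s, h0, h2⟩ := exists_perm_sorted
    fun j => edgeColour C (p₀ (σ (Fin.ofNat a 0))) (p₂ j) ^^ x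
  have ha : 0 < a := NeZero.pos a
  let e : ℕ → V := fun v => if v < a then p₀ (σ (Fin.ofNat a v)) else
    if v < a + b then p₁ (τ (Fin.ofNat b (v - a))) else
      p₂ (ρ (Fin.ofNat (n + 3) (v - (a + b))))
  have e₀ : ∀ v < a, e v = p₀ (σ (Fin.ofNat a v)) := fun v hv => if_pos hv
  have e₁ : ∀ j < b, e (a + j) = p₁ (τ (Fin.ofNat b j)) := fun j hj => by
    simp [e, hj]
  have e₂ : ∀ j, e (a + b + j) = p₂ (ρ (Fin.ofNat (n + 3) j)) := fun j => by
    simp [e, show ¬a + b + j < a by omega]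
  have hcases : ∀ v < a + b + (n + 3), (partIndex a b v = 0 ∧ ∃ i, e v = p₀ i) ∨
      (partIndex a b v = 1 ∧ ∃ i, e v = p₁ i) ∨ (partIndex a b v = 2 ∧ ∃ i, e v = p₂ i) := by
    intro v hv
    simp only [partIndex_eq, e]
    split_ifs <;> simp
  refine hasMonochromaticCover_of_coverTable hq (by omega) (by omega) hvs hO (htab m hm) e x s
    ?_ ?_ ?_ ?_ ?_
  · intro u hu v hv huv
    rcases hcases u hu with ⟨hu, i, hi⟩ | ⟨hu, i, hi⟩ | ⟨hu, i, hi⟩ <;>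
      rcases hcases v hv with ⟨hv, j, hj⟩ | ⟨hv, j, hj⟩ | ⟨hv, j, hj⟩ <;>
      first
      | exact absurd (hu.trans hv.symm) huv
      | rw [hi, hj]
        first
        | exact h₀₁ _ _
        | exact h₀₂ _ _
        | exact h₁₂ _ _
        | exact (h₀₁ _ _).symm
        | exact (h₀₂ _ _).symm
        | exact (h₁₂ _ _).symm
  · intro y
    rcases hp y with ⟨i, rfl⟩ | ⟨i, rfl⟩ | ⟨i, rfl⟩
    · refine ⟨(σ.symm i).val, by omega, ?_⟩
      rw [e₀ _ (σ.symm i).isLt]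
      simp
    · refine ⟨a + (τ.symm i).val, by omega, ?_⟩
      rw [e₁ _ (τ.symm i).isLt]
      simp
    · refine ⟨a + b + (ρ.symm i).val, by omega, ?_⟩
      rw [e₂]
      simp
  · intro u hu j hj
    rw [e₀ u hu, e₁ j hj, hM]
    simp [Nat.mod_eq_of_lt hu, Nat.mod_eq_of_lt hj]
  · have := e₂ 0
    rw [add_zero] at this
    rw [e₀ 0 ha, e₂ 1, this]
    exact h0
  · rw [e₀ 0 ha, e₂ 1, e₂ 2]
    exact h2

/-! ### Lower bounds -/

theorem HasMonochromaticCover.mono {r : ℕ} {C : G.EdgeLabeling (Fin r)} {t d d' : ℕ}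
    (h : HasMonochromaticCover C t d) (hd : d ≤ d') : HasMonochromaticCover C t d' := by
  obtain ⟨H, hH, hv⟩ := h
  exact ⟨H, fun i => ⟨(hH i).1, (hH i).2.1, (hH i).2.2.trans (by exact_mod_cast hd)⟩, hv⟩

/-- By monotonicity in the diameter, one colouring that fails at `d` excludes every smaller value
too. -/
theorem diameterCoverNumber_eq {r t d : ℕ}
    (h : ∀ C : G.EdgeLabeling (Fin r), HasMonochromaticCover C t (d + 1))
    {C : G.EdgeLabeling (Fin r)} (hC : ¬ HasMonochromaticCover C t d) :
    diameterCoverNumber G r t = (d + 1 : ℕ) := by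
  refine le_antisymm (iInf₂_le _ h) (le_iInf₂ fun d' hd' => ?_)
  by_contra hlt
  have hlt' : d' < d + 1 := by exact_mod_cast not_le.1 hlt
  exact hC ((hd' C).mono (by omega))

theorem exists_walk_length_le_of_ediam_le {α : Type*} {K : SimpleGraph α} {d : ℕ}
    (h : K.ediam ≤ d) (x y : α) : ∃ p : K.Walk x y, p.length ≤ d := by
  have hxy : K.edist x y ≤ d := SimpleGraph.edist_le_ediam.trans h
  have hr : K.Reachable x y :=
    SimpleGraph.edist_ne_top_iff_reachable.1 (ne_top_of_le_ne_top (ENat.natCast_ne_top d) hxy)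
  obtain ⟨p, hp⟩ := hr.exists_walk_length_eq_edist
  exact ⟨p, by rw [← hp] at hxy; exact_mod_cast hxy⟩

/-- A complete multipartite graph with more than `t * n` vertices, where `n` is the number of its
parts, has no cover by `t` subgraphs of diameter at most one. -/
theorem not_hasMonochromaticCover_one {ι : Type*} [Fintype ι] {W : ι → Type*}
    [∀ i, Fintype (W i)] {r t : ℕ}
    {C : (SimpleGraph.completeMultipartiteGraph W).EdgeLabeling (Fin r)}
    (h : t * Fintype.card ι < Fintype.card (Σ i, W i)) : ¬ HasMonochromaticCover C t 1 := by
  rintro ⟨H, hH, hcov⟩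
  choose f hf using hcov
  -- Two vertices of one part are never adjacent, so a subgraph of diameter at most one contains at
  -- most one of them.
  have hinj : Function.Injective fun x : Σ i, W i => (f x, x.1) := by
    intro x y hxy
    obtain ⟨h1, h2⟩ := Prod.mk.inj hxy
    have hy : y ∈ (H (f x)).verts := h1 ▸ hf y
    obtain ⟨p, hp⟩ := exists_walk_length_le_of_ediam_le (hH (f x)).2.2 ⟨x, hf x⟩ ⟨y, hy⟩
    rcases Nat.le_one_iff_eq_zero_or_eq_one.1 hp with hp | hp
    · exact congrArg Subtype.val (SimpleGraph.Walk.eq_of_length_eq_zero hp)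
    · exact absurd h2 ((H (f x)).adj_sub (SimpleGraph.Walk.adj_of_length_eq_one hp))
  have := Fintype.card_le_of_injective _ hinj
  simp only [Fintype.card_prod, Fintype.card_fin] at this
  omega

/-! ### A colouring of `K_{4,3,2}` that forces diameter three -/

/-- The number of a vertex of `K_{4,3,2}`. -/
def vertexCode (x : Σ i : Fin 3, Fin (![4, 3, 2] i)) : ℕ := ![0, 4, 7] x.1 + x.2.val

/-- The neighbourhoods, as bit masks, of a two-colouring of `K_{4,3,2}`. -/
def neighbourMask (k : Fin 2) (u : ℕ) : ℕ :=
  if k = 1 then [432, 352, 272, 128, 133, 131, 2, 57, 7].getD u 0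
  else [64, 144, 224, 368, 266, 268, 397, 70, 120].getD u 0

/-- A two-colouring of `K_{4,3,2}` without a cover by two sets of diameter at most two. -/
def extremalColouring : (completeTripartiteGraph 4 3 2).EdgeLabeling (Fin 2) :=
  SimpleGraph.EdgeLabeling.mk
    (fun x y _ => if (neighbourMask 1 (vertexCode x)).testBit (vertexCode y) then 1 else 0)
    (by
      have h : ∀ x y : Σ i : Fin 3, Fin (![4, 3, 2] i),
          (neighbourMask 1 (vertexCode y)).testBit (vertexCode x) =
            (neighbourMask 1 (vertexCode x)).testBit (vertexCode y) := by decide +kernel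
      intro x y _
      simp only [h x y])

/-- Whether any two members of the set coded by `m` are equal, adjacent or have a common
neighbour in the set. -/
def maskBounded (row : ℕ → ℕ) (m : ℕ) : Bool :=
  (List.range 9).all fun u => (List.range 9).all fun v =>
    !m.testBit u || (!m.testBit v || (Nat.beq u v || ((row u).testBit v ||
      !Nat.beq (row u &&& (row v &&& m)) 0)))

theorem or_ne_of_maskBounded :
    ((List.range 512).filter fun m =>
        maskBounded (neighbourMask 0) m || maskBounded (neighbourMask 1) m).all (fun m =>
      ((List.range 512).filter fun m =>
        maskBounded (neighbourMask 0) m || maskBounded (neighbourMask 1) m).all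
          fun m' => !Nat.beq (m ||| m') 511) = true := by
  decide +kernel

theorem testBit_neighbourMask {k : Fin 2} {x y : Σ i : Fin 3, Fin (![4, 3, 2] i)}
    (h : (completeTripartiteGraph 4 3 2).Adj x y) (hk : extremalColouring.get x y h = k) :
    (neighbourMask k (vertexCode x)).testBit (vertexCode y) = true ∧
      (neighbourMask k (vertexCode y)).testBit (vertexCode x) = true := by
  have hc : ∀ x y : Σ i : Fin 3, Fin (![4, 3, 2] i), x.1 ≠ y.1 →
      (neighbourMask (if (neighbourMask 1 (vertexCode x)).testBit (vertexCode y) then 1 else 0)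
        (vertexCode x)).testBit (vertexCode y) = true ∧
      (neighbourMask (if (neighbourMask 1 (vertexCode x)).testBit (vertexCode y) then 1 else 0)
        (vertexCode y)).testBit (vertexCode x) = true := by decide +kernel
  subst hk
  exact hc x y h

open scoped Classical in
/-- The bit mask of a set of vertices of `K_{4,3,2}`. -/
noncomputable def setMask (S : Set (Σ i : Fin 3, Fin (![4, 3, 2] i))) : ℕ :=
  Nat.ofBits (n := 9) fun t => decide (∃ x ∈ S, vertexCode x = t)

theorem vertexCode_lt (x : Σ i : Fin 3, Fin (![4, 3, 2] i)) : vertexCode x < 9 := by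
  revert x
  decide +kernel

theorem testBit_setMask {S : Set (Σ i : Fin 3, Fin (![4, 3, 2] i))} {t : ℕ} :
    (setMask S).testBit t = true ↔ ∃ x ∈ S, vertexCode x = t := by
  rcases lt_or_ge t 9 with ht | ht
  · rw [setMask, Nat.testBit_ofBits_lt _ _ ht]
    simp
  · rw [setMask, Nat.testBit_ofBits_ge _ _ ht]
    simp only [Bool.false_eq_true, false_iff, not_exists, not_and]
    intro x _ hx
    have := vertexCode_lt x
    omega

/-- A walk of length at most two inside `H` is trivial, an edge, or passes through a common
neighbour in `H`. Thus the finite test on vertex sets covers non-induced subgraphs as well. -/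
theorem maskBounded_setMask {H : (completeTripartiteGraph 4 3 2).Subgraph}
    (hH : IsMonochromatic extremalColouring H) (hd : H.coe.ediam ≤ (2 : ℕ)) :
    ∃ k, maskBounded (neighbourMask k) (setMask H.verts) = true := by
  obtain ⟨k, hk⟩ := hH
  refine ⟨k, ?_⟩
  have hadj : ∀ {x y : H.verts}, H.coe.Adj x y →
      (neighbourMask k (vertexCode x)).testBit (vertexCode y) = true ∧
      (neighbourMask k (vertexCode y)).testBit (vertexCode x) = true := fun {x y} h =>
    testBit_neighbourMask (H.adj_sub h) (hk s(x.1, y.1) h)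
  simp only [maskBounded, List.all_eq_true, Bool.or_eq_true, Bool.not_eq_true']
  intro u _ v _
  by_cases hu : (setMask H.verts).testBit u = true
  swap
  · exact Or.inl (by simpa using hu)
  by_cases hv : (setMask H.verts).testBit v = true
  swap
  · exact Or.inr (Or.inl (by simpa using hv))
  refine Or.inr (Or.inr ?_)
  obtain ⟨x, hx, rfl⟩ := testBit_setMask.1 hu
  obtain ⟨y, hy, rfl⟩ := testBit_setMask.1 hv
  obtain ⟨p, hp⟩ := exists_walk_length_le_of_ediam_le hd ⟨x, hx⟩ ⟨y, hy⟩
  cases p with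
  | nil => exact Or.inl (by simp)
  | @cons _ w _ h p =>
    cases p with
    | nil => exact Or.inr (Or.inl (hadj h).1)
    | cons h' p =>
      cases p with
      | cons _ _ => simp at hp
      | nil =>
        refine Or.inr (Or.inr (Bool.eq_false_iff.2 fun h0 => ?_))
        have hw : (setMask H.verts).testBit (vertexCode w) = true :=
          testBit_setMask.2 ⟨w, w.2, rfl⟩
        have := congrArg (fun m => m.testBit (vertexCode w)) (Nat.eq_of_beq_eq_true h0)
        have h1 := (hadj h).1
        have h2 := (hadj h').2
        simp [h1, h2, hw] at this

theorem not_hasMonochromaticCover_extremalColouring :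
    ¬ HasMonochromaticCover extremalColouring 2 2 := by
  rintro ⟨H, hH, hcov⟩
  have hmem : ∀ i, setMask (H i).verts ∈ (List.range 512).filter fun m =>
      maskBounded (neighbourMask 0) m || maskBounded (neighbourMask 1) m := by
    intro i
    obtain ⟨k, hk⟩ := maskBounded_setMask (hH i).1 (hH i).2.2
    refine List.mem_filter.2 ⟨List.mem_range.2 (Nat.ofBits_lt_two_pow _), ?_⟩
    fin_cases k
    · exact Bool.or_eq_true_iff.2 (Or.inl hk)
    · exact Bool.or_eq_true_iff.2 (Or.inr hk)
  have h := List.all_eq_true.1 (List.all_eq_true.1 or_ne_of_maskBounded _ (hmem 0)) _ (hmem 1)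
  -- 511 has all nine bits set, so it is the mask of the whole vertex set.
  have hne : setMask (H 0).verts ||| setMask (H 1).verts ≠ 511 := fun h' => by
    rw [h'] at h
    exact absurd h (by decide)
  refine hne (Nat.eq_of_testBit_eq fun t => ?_)
  rcases lt_or_ge t 9 with ht | ht
  · have hcode : ∀ t < 9, ∃ x, vertexCode x = t := by decide +kernel
    obtain ⟨x, rfl⟩ := hcode t ht
    obtain ⟨i, hi⟩ := hcov x
    have hbit : (setMask (H i).verts).testBit (vertexCode x) = true :=
      testBit_setMask.2 ⟨x, hi, rfl⟩
    have h511 : ∀ t < 9, (511 : ℕ).testBit t = true := by decide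
    rw [h511 _ ht, Nat.testBit_or, Bool.or_eq_true]
    fin_cases i
    · exact Or.inl hbit
    · exact Or.inr hbit
  · rw [Nat.testBit_lt_two_pow, Nat.testBit_lt_two_pow]
    · exact lt_of_lt_of_le (by norm_num) (Nat.pow_le_pow_right two_pos ht)
    · exact (Nat.or_lt_two_pow (Nat.ofBits_lt_two_pow _) (Nat.ofBits_lt_two_pow _)).trans_le
        (Nat.pow_le_pow_right two_pos ht)

/-! ### The tables of the three graphs -/

/-- The table of `K_{3,3,3}` for diameter two. -/
def coverTableThree : ℕ → ℕ :=
  coverTable 3 3 3 17 1 [0, 1, 2, 3, 4, 5, 6, 7, 8]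
    [221, 212, 122, 222, 123, 132, 213, 231, 312, 321] [] []

/-- The table of `K_{4,3,2}` for diameter three. -/
def coverTableFour : ℕ → ℕ :=
  coverTable 2 3 4 19 2 [0, 1, 2, 3, 4, 5, 6, 7, 8] [321, 222] [] []

/-- The table of `K_{4,2,2}` for diameter two. -/
def coverTableTwo : ℕ → ℕ :=
  coverTable 2 2 4 15 1 [0, 1, 2, 3, 4, 5, 6, 7] [221, 212, 311, 211, 121, 112, 322]
    [0, 1, 2, 3] [222, 212, 221]

/-- Each goal treats `2 ^ 15` colourings at once. Only for this graph are sets sharing a vertex also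
admitted. -/
theorem coverTableTwo_eq : ∀ m ∈ [0, 1, 3, 5, 6], coverTableTwo m = tableTrue 15 := by
  simp only [List.forall_mem_cons, List.not_mem_nil, false_implies, implies_true, and_true]
  refine ⟨?_, ?_, ?_, ?_, ?_⟩
  all_goals decide +kernel

theorem coverTableFour_eq : ∀ m ∈ [0, 1, 3, 7, 9, 10, 11, 14],
    coverTableFour m = tableTrue 19 := by
  simp only [List.forall_mem_cons, List.not_mem_nil, false_implies, implies_true, and_true]
  refine ⟨?_, ?_, ?_, ?_, ?_, ?_, ?_, ?_⟩
  all_goals decide +kernel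

theorem coverTableThree_eq : ∀ m ∈ normalFormsThree, coverTableThree m = tableTrue 17 := by
  simp only [normalFormsThree, List.forall_mem_cons, List.not_mem_nil, false_implies, implies_true, and_true]
  refine ⟨?_, ?_, ?_, ?_, ?_, ?_, ?_, ?_, ?_, ?_, ?_,
    ?_, ?_, ?_, ?_, ?_, ?_, ?_⟩
  all_goals decide +kernel

end DiameterCover

theorem mainTheorem5 :
    DiameterCover.diameterCoverNumber (DiameterCover.completeTripartiteGraph 4 3 2) 2 2 = 3 ∧
    DiameterCover.diameterCoverNumber (DiameterCover.completeTripartiteGraph 4 2 2) 2 2 = 2 ∧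
    DiameterCover.diameterCoverNumber (DiameterCover.completeTripartiteGraph 3 3 3) 2 2 = 2 := by
  refine ⟨DiameterCover.diameterCoverNumber_eq (d := 2) (fun C => ?_)
      DiameterCover.not_hasMonochromaticCover_extremalColouring,
    -- The counting bound ignores colours, so any colouring serves as witness.
    DiameterCover.diameterCoverNumber_eq (d := 1) (C := fun _ => 0) (fun C => ?_)
      (DiameterCover.not_hasMonochromaticCover_one (by decide)),
    DiameterCover.diameterCoverNumber_eq (d := 1) (C := fun _ => 0) (fun C => ?_)
      (DiameterCover.not_hasMonochromaticCover_one (by decide))⟩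
  -- The part of size four goes last, leaving a small `2 × 3` matrix to normalise.
  · refine DiameterCover.hasMonochromaticCover_of_forall_coverTable (n := 1)
      DiameterCover.isNormalForms_two_three rfl (fun v => ?_) (by simp)
      DiameterCover.coverTableFour_eq (fun j => ⟨2, j⟩) (fun j => ⟨1, j⟩) (fun j => ⟨0, j⟩)
      (fun i j => ?_) (fun i j => ?_) (fun i j => ?_) (fun y => ?_) C
    · simp only [List.mem_cons, List.not_mem_nil, or_false]; omega
    · simp
    · simp
    · simp
    · obtain ⟨i, j⟩ := y
      fin_cases i
      · exact Or.inr (Or.inr ⟨j, rfl⟩)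
      · exact Or.inr (Or.inl ⟨j, rfl⟩)
      · exact Or.inl ⟨j, rfl⟩
  · refine DiameterCover.hasMonochromaticCover_of_forall_coverTable (n := 1)
      DiameterCover.isNormalForms_two_two rfl (fun v => ?_) (by simp)
      DiameterCover.coverTableTwo_eq (fun j => ⟨1, j⟩) (fun j => ⟨2, j⟩) (fun j => ⟨0, j⟩)
      (fun i j => ?_) (fun i j => ?_) (fun i j => ?_) (fun y => ?_) C
    · simp only [List.mem_cons, List.not_mem_nil, or_false]; omega
    · simp
    · simp
    · simp
    · obtain ⟨i, j⟩ := y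
      fin_cases i
      · exact Or.inr (Or.inr ⟨j, rfl⟩)
      · exact Or.inl ⟨j, rfl⟩
      · exact Or.inr (Or.inl ⟨j, rfl⟩)
  · refine DiameterCover.hasMonochromaticCover_of_forall_coverTable (n := 0)
      DiameterCover.isNormalForms_three_three rfl (fun v => ?_) (by simp)
      DiameterCover.coverTableThree_eq (fun j => ⟨0, j⟩) (fun j => ⟨1, j⟩) (fun j => ⟨2, j⟩)
      (fun i j => ?_) (fun i j => ?_) (fun i j => ?_) (fun y => ?_) C
    · simp only [List.mem_cons, List.not_mem_nil, or_false]; omega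
    · simp
    · simp
    · simp
    · obtain ⟨i, j⟩ := y
      fin_cases i
      · exact Or.inl ⟨j, rfl⟩
      · exact Or.inr (Or.inl ⟨j, rfl⟩)
      · exact Or.inr (Or.inr ⟨j, rfl⟩)
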